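/- Let $k$ be a field and $\mathfrak a$ a $k$-linear category. **Hochschild cohomology.** For a $\mathbb Z$-graded $k$-quiver $\mathfrak q$ (a set of objects with a graded $k$-module $\mathfrak q(A,A')$ for any two objects), let $\mathbf C(\mathfrak q)=\prod_{n\ge 0}\prod_{A_0,\dots,A_n}\mathrm{Hom}_k\big(\mathfrak q(A_{n-1},A_n)\otimes\cdots\otimes\mathfrak q(A_0,A_1),\,\mathfrak q(A_0,A_n)\big)$, where a map with $n$ arguments and internal degree $i$ has degree $n+i$. Identify such a map $\phi$ with a map of degree $n+i-1$ on the shifted modules $\Sigma\mathfrak q$, by the sign $(-1)^{ni+(n-1)|f_n|+\cdots+|f_2|}$ on arguments $(f_n,\dots,f_1)$. On the shifted maps, $\phi\{\psi_1,\dots,\psi_m\}$ is the brace operation: the sum, with Koszul signs, over all insertions of $\psi_1,\dots,\psi_m$ (in this order) into $\phi$. Regard $\mathfrak a$ as a quiver in degree $0$, with composition $m\in\mathbf C^2(\mathfrak a)$. Then $\mathbf C(\mathfrak a)$ is the Hochschild complex with differential $\langle m,-\rangle$, where $\langle x,y\rangle=x\{y\}-(-1)^{|x||y|}y\{x\}$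 (shifted degrees), and $HH^2(\mathfrak a)$ is its second cohomology. **The characteristic morphism.** Let $\mathsf{Com}(\mathfrak a)$ be the dg category of complexes over $\mathfrak a$, $K(\mathfrak a)$ its homotopy category, and $\mathsf{PCom}(\mathfrak a)$ the graded quiver of precomplexes $(C,\delta_C)$ ($\delta_C$ any degree-one endomorphism of the graded object $C$), with $\mathsf{PCom}(\mathfrak a)(C,D)^n=\prod_p\mathfrak a(C^p,D^{p+n})$. Extend $\phi\in\mathbf C^n(\mathfrak a)$ componentwise to $\mathsf{PCom}(\mathfrak a)$, let $\delta=(\delta_C)_C\in\mathbf C^1(\mathsf{PCom}(\mathfrak a))$, and put $\mathrm{embr}_\delta(\phi)=\sum_{j=0}^n\phi\{\delta^{\otimes j}\}$. The lifted characteristic morphism is $$\bar\chi_{\mathfrak a}:\mathbf C^n(\mathfrak a)\to\prod_{C\in\mathsf{Com}(\mathfrak a)}\mathsf{Com}(\mathfrak a)^n(C,C),$$ where $\bar\chi_{\mathfrak a}(\phi)_C$ is the part with no arguments of $\mathrm{embr}_\delta(\phi)$ at $C$. In cohomology it induces the characteristic morphism $\chi_{\mathfrak a}:HH^2(\mathfrak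 a)\to\mathfrak Z^2K(\mathfrak a)$, where $\mathfrak Z^nK(\mathfrak a)$ is the degree-$n$ part of the graded centre: the families $(\zeta_C\in K(\mathfrak a)(C,C[n]))_C$ with $\zeta_Df=(-1)^{mn}f\zeta_C$ for all $f\in K(\mathfrak a)(C,D[m])$. **Deformations and obstructions.** For a Hochschild $2$-cocycle $\phi$ representing $c\in HH^2(\mathfrak a)$, let $\mathfrak a_\phi[\epsilon]$ be the first order deformation of $\mathfrak a$ (a $k[\epsilon]$-linear category, $\epsilon^2=0$) with the objects of $\mathfrak a$, morphism modules $\mathfrak a(A,A')[\epsilon]$ and composition $m+\phi\epsilon$; this is the deformation $\mathfrak a_c[\epsilon]$. For a complex $C=(C,\delta_C)$ over $\mathfrak a$, a graded lift of $C$ is a degree-one endomorphism $\bar\delta$ over $\mathfrak a_\phi[\epsilon]$ of the graded object $C$ that reduces to $\delta_C$ modulo $\epsilon$. Graded lifts exist. The curvature of a graded lift is of the form $-\bar\delta^2=u\,\epsilon$ with $u\in\mathsf{Com}(\mathfrak a)^2(C,C)$ a cocycle. The obstruction $o_C\in K(\mathfrak a)(C,C[2])$ to lifting $C$ to an object of $K(\mathfrak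 a_c[\epsilon])$ is the class of $u$. **Theorem.** 1. For every $\phi\in\mathbf C^2(\mathfrak a)$ and every complex $C$ over $\mathfrak a$, $\ \bar\chi_{\mathfrak a}(\phi)_C=-\phi(\delta_C,\delta_C)$. 2. For every $c\in HH^2(\mathfrak a)$, every cocycle $\phi$ representing $c$ and every $C\in K(\mathfrak a)$, the class $o_C$ does not depend on the graded lift, and $\chi_{\mathfrak a}(c)_C=o_C$; that is, $\chi_{\mathfrak a}(c)=(o_C)_{C\in K(\mathfrak a)}$. 3. In the situation of 2, $\chi_{\mathfrak a}(c)_C=0$ if and only if $C$ lifts along $k\otimes_{k[\epsilon]}-:K(\mathfrak a_\phi[\epsilon])\to K(\mathfrak a)$, i.e. there is $D\in K(\mathfrak a_\phi[\epsilon])$ with $k\otimes_{k[\epsilon]}D\cong C$ in $K(\mathfrak a)$. -/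

import Mathlib

open CategoryTheory

universe w v u

noncomputable section

namespace HochChar


/-- A graded `k`-quiver: a set of objects and a `ℤ`-graded `k`-module of morphisms between any two
objects. The graded module is given by its homogeneous parts `gr A B n`, realised as submodules of
an ambient module `Hom A B`; only the homogeneous parts are used. -/
structure GradedQuiver (k : Type w) [CommRing k] where
  Ob : Type u
  Hom : Ob → Ob → Type v
  [addCommGroup : ∀ A B, AddCommGroup (Hom A B)]
  [module : ∀ A B, Module k (Hom A B)]
  gr : ∀ A B, ℤ → Submodule k (Hom A B)

instance {k : Type w} {_ : CommRing k} (Q : GradedQuiver.{w, v, u} k) (A B : Q.Ob) :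
    AddCommGroup (Q.Hom A B) := Q.addCommGroup A B

instance {k : Type w} {_ : CommRing k} (Q : GradedQuiver.{w, v, u} k) (A B : Q.Ob) :
    Module k (Q.Hom A B) := Q.module A B

namespace GradedQuiver

variable {k : Type w} [CommRing k] (Q : GradedQuiver.{w, v, u} k)

/-- Chains of composable homogeneous elements `A₀ → A₁ → ⋯ → Aₙ`. The chain `cons f₁ (cons f₂ ⋯)`
starts at `A₀` with `f₁ : A₀ → A₁`; in the order of composition it is `(fₙ, …, f₁)`. Empty chains
at an object are included. -/
inductive Chain : Q.Ob → Q.Ob → Type (max u v)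
  | nil (A : Q.Ob) : Chain A A
  | cons {A B C : Q.Ob} (d : ℤ) (f : Q.gr A B d) (c : Chain B C) : Chain A C

variable {Q}

namespace Chain

/-- The number `n` of elements of a chain. -/
def length : {A B : Q.Ob} → Q.Chain A B → ℤ
  | _, _, nil _ => 0
  | _, _, cons _ _ c => length c + 1

/-- The total degree `|f₁| + ⋯ + |fₙ|`. -/
def deg : {A B : Q.Ob} → Q.Chain A B → ℤ
  | _, _, nil _ => 0
  | _, _, cons d _ c => d + deg c

/-- The number `(n - 1)|fₙ| + ⋯ + 2|f₃| + |f₂|` that occurs in the sign rule for (de)suspension. -/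
def weight : {A B : Q.Ob} → Q.Chain A B → ℤ
  | _, _, nil _ => 0
  | _, _, cons _ _ c => weight c + deg c

/-- Concatenation of chains. -/
def append : {A B C : Q.Ob} → Q.Chain A B → Q.Chain B C → Q.Chain A C
  | _, _, _, nil _, c' => c'
  | _, _, _, cons d f c, c' => cons d f (append c c')

/-- All ways to write a chain as a concatenation of two chains. -/
def splits : {A C : Q.Ob} → Q.Chain A C → List ((B : Q.Ob) × Q.Chain A B × Q.Chain B C)
  | _, _, nil A => [⟨A, nil A, nil A⟩]
  | A, _, cons d f c => ⟨A, nil A, cons d f c⟩ ::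
      (splits c).map fun s => ⟨s.1, cons d f s.2.1, s.2.2⟩

/-- The degree of `(σfₙ, …, σf₁)` in the bar construction, where `σ` lowers the degree by one. -/
def bdeg {A B : Q.Ob} (c : Q.Chain A B) : ℤ := c.deg - c.length

@[simp] lemma bdeg_nil (A : Q.Ob) : (nil A).bdeg = 0 := rfl
@[simp] lemma bdeg_cons {A B C : Q.Ob} (d : ℤ) (f : Q.gr A B d) (c : Q.Chain B C) :
    (cons d f c).bdeg = d - 1 + c.bdeg := by simp only [bdeg, deg, length]; ring

@[simp] lemma bdeg_append {A B C : Q.Ob} (c : Q.Chain A B) (c' : Q.Chain B C) :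
    (c.append c').bdeg = c.bdeg + c'.bdeg := by
  induction c with
  | nil => simp [append]
  | cons d f c ih => simp [append, ih, add_assoc]

lemma deg_append {A B C : Q.Ob} (c : Q.Chain A B) (c' : Q.Chain B C) :
    (c.append c').deg = c.deg + c'.deg := by
  induction c with
  | nil => simp [append, deg]
  | cons d f c ih => simp [append, deg, ih, add_assoc]

lemma length_append {A B C : Q.Ob} (c : Q.Chain A B) (c' : Q.Chain B C) :
    (c.append c').length = c.length + c'.length := by
  induction c with
  | nil => simp [append, length]
  | cons d f c ih => simp only [append, length, ih]; ring

lemma append_assoc {A B C D : Q.Ob} (c : Q.Chain A B) (c' : Q.Chain B C) (c'' : Q.Chain C D) :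
    (c.append c').append c'' = c.append (c'.append c'') := by
  induction c with
  | nil => rfl
  | cons d f c ih => simp [append, ih]

lemma append_of_mem_splits {A C : Q.Ob} {c : Q.Chain A C} :
    ∀ s ∈ c.splits, s.2.1.append s.2.2 = c := by
  induction c with
  | nil => simp [splits, append]
  | cons d f c ih =>
    intro s hs
    simp only [splits, List.mem_cons, List.mem_map] at hs
    rcases hs with rfl | ⟨t, ht, rfl⟩
    · rfl
    · simp [append, ih t ht]

end Chain

variable (Q)

/-- Families of (not necessarily multilinear) maps on chains, of every length. -/
abbrev Raw := ∀ A B : Q.Ob, Q.Chain A B → Q.Hom A B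

instance : AddCommGroup Q.Raw := Pi.addCommGroup

instance : AddCommMonoid Q.Raw := AddCommGroup.toAddCommMonoid

instance : Module k Q.Raw := Pi.module _ _ _

open Chain

/-- The degree `p` part `C^p(Q)` of the Hochschild object
`∏_{n ≥ 0} ∏_{A₀, …, Aₙ} Hom(Q(Aₙ₋₁, Aₙ) ⊗ ⋯ ⊗ Q(A₀, A₁), Q(A₀, Aₙ))` of a graded quiver.
An element is given by its values on chains; it is linear in each slot, and the component with `n`
arguments has internal degree `p - n`, that is, it sends a chain `c` to degree `bdeg c + p`. -/
def cochains (p : ℤ) : Submodule k Q.Raw where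
  carrier := {φ | (∀ (A B : Q.Ob) (c : Q.Chain A B), φ A B c ∈ Q.gr A B (c.bdeg + p)) ∧
    ∀ (A B C D : Q.Ob) (c : Q.Chain A B) (d : ℤ) (c' : Q.Chain C D),
      IsLinearMap k fun f : Q.gr B C d => φ A D (c.append (cons d f c'))}
  add_mem' := fun {φ ψ} hφ hψ => ⟨fun A B c => add_mem (hφ.1 A B c) (hψ.1 A B c),
    fun A B C D c d c' => ⟨fun f g => by
      simp only [Pi.add_apply, (hφ.2 A B C D c d c').map_add, (hψ.2 A B C D c d c').map_add]; abel,
      fun r f => by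
      simp only [Pi.add_apply, (hφ.2 A B C D c d c').map_smul, (hψ.2 A B C D c d c').map_smul,
        smul_add]⟩⟩
  zero_mem' := ⟨fun _ _ _ => zero_mem _, fun _ _ _ _ _ _ _ => ⟨fun _ _ => by simp, fun _ _ => by simp⟩⟩
  smul_mem' := fun r φ hφ => ⟨fun A B c => Submodule.smul_mem _ r (hφ.1 A B c),
    fun A B C D c d c' => ⟨fun f g => by
      simp only [Pi.smul_apply, (hφ.2 A B C D c d c').map_add, smul_add],
      fun s f => by
      simp only [Pi.smul_apply, (hφ.2 A B C D c d c').map_smul, smul_comm r s]⟩⟩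

variable {Q}

/-- A cochain together with its degree. -/
abbrev SomeCochain (Q : GradedQuiver.{w, v, u} k) := (p : ℤ) × Q.cochains p

/-- All ways to insert the values of `ψs` on disjoint consecutive subchains into a chain. The list `ψs`
is read from the source side. An inserted `ψ`, of bar degree `p - 1`, passes the elements to the left
of its place in the order of composition, which are those that come later in the chain; this gives
the Koszul sign. -/
def insertions : List (SomeCochain Q) → {A C : Q.Ob} → Q.Chain A C → List (ℤˣ × Q.Chain A C)
  | [], _, _, c => [(1, c)]
  | ψ :: ψs, _, _, c => c.splits.flatMap fun s => s.2.2.splits.flatMap fun t =>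
      (insertions ψs t.2.2).map fun x =>
        (((ψ.1 - 1) * t.2.2.bdeg).negOnePow * x.1,
          s.2.1.append (cons (t.2.1.bdeg + ψ.1) ⟨ψ.2.1 _ _ t.2.1, ψ.2.2.1 _ _ t.2.1⟩ x.2))

/-- The values of the brace operation. -/
def braceRaw {p : ℤ} (φ : Q.cochains p) (ψs : List (SomeCochain Q)) : Q.Raw := fun A B c =>
  ((insertions ψs.reverse c).map fun x => x.1 • φ.1 A B x.2).sum

lemma bdeg_of_mem_insertions (ψs : List (SomeCochain Q)) {A C : Q.Ob} (c : Q.Chain A C) :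
    ∀ x ∈ insertions ψs c, x.2.bdeg = c.bdeg + (ψs.map fun ψ => ψ.1 - 1).sum := by
  induction ψs generalizing A C with
  | nil => simp [insertions]
  | cons ψ ψs ih =>
    intro x hx
    simp only [insertions, List.mem_flatMap, List.mem_map] at hx
    obtain ⟨s, hs, t, ht, y, hy, rfl⟩ := hx
    have h1 := congrArg bdeg (append_of_mem_splits s hs)
    have h2 := congrArg bdeg (append_of_mem_splits t ht)
    simp only [bdeg_append, bdeg_cons, List.map_cons, List.sum_cons] at h1 h2 ⊢
    rw [ih _ y hy]
    linarith

section
variable {M : Type*} [AddCommGroup M]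

lemma sum_splits_append {A B C : Q.Ob} (c : Q.Chain A B) (d : ℤ) {B' : Q.Ob} (f : Q.gr B B' d)
    (c' : Q.Chain B' C) (G : (D : Q.Ob) × Q.Chain A D × Q.Chain D C → M) :
    ((c.append (cons d f c')).splits.map G).sum =
      (c.splits.map fun s => G ⟨s.1, s.2.1, s.2.2.append (cons d f c')⟩).sum +
      (c'.splits.map fun s => G ⟨s.1, c.append (cons d f s.2.1), s.2.2⟩).sum := by
  induction c with
  | nil A =>
    simp [append, splits, Function.comp_def]
  | cons e g c ih =>
    simp only [append, splits, List.map_cons, List.sum_cons, List.map_map, Function.comp_def]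
    rw [ih f (fun s => G ⟨s.1, cons e g s.2.1, s.2.2⟩)]
    simp [append, add_assoc]

end

lemma isLinearMap_list_sum {k M N ι : Type*} [CommRing k] [AddCommGroup M] [AddCommGroup N] [Module k M] [Module k N]
    (l : List ι) (F : ι → M → N) (h : ∀ i ∈ l, IsLinearMap k (F i)) :
    IsLinearMap k fun m => (l.map fun i => F i m).sum := by
  induction l with
  | nil => exact ⟨by simp, by simp⟩
  | cons i l ih =>
    have h1 := h i (by simp)
    have h2 := ih fun j hj => h j (by simp [hj])
    exact ⟨fun x y => by simp only [List.map_cons, List.sum_cons, h1.map_add, h2.map_add]; abel,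
      fun r x => by simp only [List.map_cons, List.sum_cons, h1.map_smul, h2.map_smul, smul_add]⟩

lemma isLinearMap_units_smul {k M N : Type*} [CommRing k] [AddCommGroup M] [AddCommGroup N] [Module k M] [Module k N]
    (s : ℤˣ) {F : M → N} (h : IsLinearMap k F) : IsLinearMap k fun m => s • F m :=
  ⟨fun x y => by rw [h.map_add, smul_add], fun r x => by
    rw [h.map_smul]; simp only [Units.smul_def]; rw [smul_comm]⟩

lemma isLinearMap_add {k M N : Type*} [CommRing k] [AddCommGroup M] [AddCommGroup N] [Module k M] [Module k N]
    {F G : M → N} (h : IsLinearMap k F) (h' : IsLinearMap k G) : IsLinearMap k fun m => F m + G m :=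
  ⟨fun x y => by rw [h.map_add, h'.map_add]; abel, fun r x => by
    rw [h.map_smul, h'.map_smul, smul_add]⟩

lemma cons_congr {A B C : Q.Ob} {d d' : ℤ} (h : d = d') (x : Q.Hom A B) (hx : x ∈ Q.gr A B d)
    (c : Q.Chain B C) : (cons d ⟨x, hx⟩ c : Q.Chain A C) = cons d' ⟨x, h ▸ hx⟩ c := by
  subst h; rfl

lemma sum_flatMap_map {α β M : Type*} [AddCommMonoid M] (l : List α) (g : α → List β) (h : β → M) :
    ((l.flatMap g).map h).sum = (l.map fun i => ((g i).map h).sum).sum := by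
  induction l with
  | nil => simp
  | cons a l ih => simp [ih]

lemma sum_insertions_cons {M : Type*} [AddCommGroup M] (ψ : SomeCochain Q)
    (ψs : List (SomeCochain Q)) {A C : Q.Ob} (c : Q.Chain A C) (F : Q.Chain A C → M) :
    ((insertions (ψ :: ψs) c).map fun x => x.1 • F x.2).sum =
      (c.splits.map fun s => (s.2.2.splits.map fun t =>
        ((ψ.1 - 1) * t.2.2.bdeg).negOnePow • ((insertions ψs t.2.2).map fun x => x.1 •
          F (s.2.1.append (cons (t.2.1.bdeg + ψ.1) ⟨ψ.2.1 _ _ t.2.1, ψ.2.2.1 _ _ t.2.1⟩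
            x.2))).sum).sum).sum := by
  simp only [insertions, sum_flatMap_map, List.map_map, Function.comp_def, mul_smul,
    List.smul_sum]

lemma insertions_linear (ψs : List (SomeCochain Q)) {A B C D : Q.Ob} (c : Q.Chain A B) (d : ℤ)
    (c' : Q.Chain C D) {M : Type*} [AddCommGroup M] [Module k M] (F : Q.Chain A D → M)
    (hF : ∀ (A' B' : Q.Ob) (e : Q.Chain A A') (n : ℤ) (e' : Q.Chain B' D),
      IsLinearMap k fun f : Q.gr A' B' n => F (e.append (cons n f e'))) :
    IsLinearMap k fun f : Q.gr B C d =>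
      ((insertions ψs (c.append (cons d f c'))).map fun x => x.1 • F x.2).sum := by
  induction ψs generalizing A B C D d c c' with
  | nil => simpa [insertions] using hF B C c d c'
  | cons ψ ψs ih =>
    simp only [sum_insertions_cons, sum_splits_append]
    refine isLinearMap_add (isLinearMap_list_sum _ _ fun s _ => isLinearMap_add
      (isLinearMap_list_sum _ _ fun t _ => ?_) (isLinearMap_list_sum _ _ fun t _ => ?_))
      (isLinearMap_list_sum _ _ fun s _ => isLinearMap_list_sum _ _ fun t _ => ?_)
    · simp only [bdeg_append, bdeg_cons]
      refine isLinearMap_units_smul _ (ih t.2.2 d c' (fun y => F (s.2.1.append (cons (t.2.1.bdeg + ψ.1)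
        ⟨ψ.2.1 _ _ t.2.1, ψ.2.2.1 _ _ t.2.1⟩ y))) ?_)
      intro A' B' e n e'
      simpa only [append_assoc, append] using hF A' B' (s.2.1.append (cons (t.2.1.bdeg + ψ.1)
        ⟨ψ.2.1 _ _ t.2.1, ψ.2.2.1 _ _ t.2.1⟩ e)) n e'
    · refine isLinearMap_units_smul _ (isLinearMap_list_sum _ _ fun x _ =>
        isLinearMap_units_smul _ ?_)
      have hdeg : ∀ f : Q.gr B C d, (s.2.2.append (cons d f t.2.1)).bdeg + ψ.1 =
          s.2.2.bdeg + (d - 1 + t.2.1.bdeg) + ψ.1 := fun f => by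
        simp only [bdeg_append, bdeg_cons]
      have h1 := hF _ _ s.2.1 (s.2.2.bdeg + (d - 1 + t.2.1.bdeg) + ψ.1) x.2
      have h2 := ψ.2.2.2 _ _ _ _ s.2.2 d t.2.1
      have h3 : ∀ f : Q.gr B C d, ψ.2.1 _ _ (s.2.2.append (cons d f t.2.1)) ∈
          Q.gr s.1 t.1 (s.2.2.bdeg + (d - 1 + t.2.1.bdeg) + ψ.1) := fun f =>
        hdeg f ▸ ψ.2.2.1 _ _ _
      have h4 : ∀ f : Q.gr B C d, F (s.2.1.append (cons
          ((s.2.2.append (cons d f t.2.1)).bdeg + ψ.1) ⟨ψ.2.1 _ _ (s.2.2.append (cons d f t.2.1)),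
            ψ.2.2.1 _ _ _⟩ x.2)) = F (s.2.1.append (cons _ ⟨_, h3 f⟩ x.2)) := fun f => by
        rw [cons_congr (hdeg f)]
      simp only [h4]
      refine ⟨fun f g => ?_, fun r f => ?_⟩
      · rw [← h1.map_add]
        congr 3
        exact Subtype.ext (h2.map_add f g)
      · rw [← h1.map_smul]
        congr 3
        exact Subtype.ext (h2.map_smul r f)
    · refine isLinearMap_units_smul _ (isLinearMap_list_sum _ _ fun x _ =>
        isLinearMap_units_smul _ ?_)
      simp only [append_assoc, append]
      exact hF _ _ c d (s.2.1.append (cons (t.2.1.bdeg + ψ.1) ⟨ψ.2.1 _ _ t.2.1, ψ.2.2.1 _ _ t.2.1⟩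
        x.2))

lemma braceRaw_mem {p q : ℤ} (φ : Q.cochains p) (ψs : List (SomeCochain Q))
    (h : p + (ψs.map fun ψ => ψ.1 - 1).sum = q) : braceRaw φ ψs ∈ Q.cochains q := by
  refine ⟨fun A B c => list_sum_mem fun y hy => ?_, fun A B C D c d c' => ?_⟩
  · obtain ⟨x, hx, rfl⟩ := List.mem_map.1 hy
    have h1 := φ.2.1 _ _ x.2
    rw [bdeg_of_mem_insertions _ c x hx, List.map_reverse, List.sum_reverse] at h1
    rw [show c.bdeg + q = c.bdeg + (ψs.map fun ψ => ψ.1 - 1).sum + p by linarith, Units.smul_def]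
    exact zsmul_mem h1 _
  · exact insertions_linear _ c d c' (φ.1 A D) fun A' B' e n e' => φ.2.2 _ _ _ _ e n e'

/-- The brace `φ{ψ₁, …, ψₘ}` of bar cochains: the sum over all insertions of `ψ₁, …, ψₘ`, in this
order of composition, with Koszul signs. Bar cochains are stored in the same modules
`cochains p`, the degree in the bar construction being `p - 1`. -/
def brace {p : ℤ} (φ : Q.cochains p) (ψs : List (SomeCochain Q)) (q : ℤ)
    (h : p + (ψs.map fun ψ => ψ.1 - 1).sum = q) : Q.cochains q :=
  ⟨braceRaw φ ψs, braceRaw_mem φ ψs h⟩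

/-- The bracket `⟨x, y⟩ = x{y} - (-1)^{|x||y|} y{x}`, with bar degrees `|x| = p - 1`, `|y| = q - 1`. -/
def bracket {p q : ℤ} (x : Q.cochains p) (y : Q.cochains q) (r : ℤ) (h : p + (q - 1) = r) :
    Q.cochains r :=
  brace x [⟨q, y⟩] r (by simpa using h) -
    ((p - 1) * (q - 1)).negOnePow • brace y [⟨p, x⟩] r (by simp; linarith)

lemma brace_add {p : ℤ} (φ φ' : Q.cochains p) (ψs : List (SomeCochain Q)) (q : ℤ) (h) :
    brace (φ + φ') ψs q h = brace φ ψs q h + brace φ' ψs q h := by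
  ext A B c
  simp [brace, braceRaw, List.sum_map_add]

lemma brace_smul {p : ℤ} (r : k) (φ : Q.cochains p) (ψs : List (SomeCochain Q)) (q : ℤ) (h) :
    brace (r • φ) ψs q h = r • brace φ ψs q h := by
  ext A B c
  simp only [brace, braceRaw, Submodule.coe_smul, Pi.smul_apply, List.smul_sum, List.map_map]
  congr 2
  ext x
  simp only [Function.comp_apply, Units.smul_def]
  rw [smul_comm]

lemma isLinearMap_brace_singleton {p q : ℤ} (x : Q.cochains p) (r : ℤ)
    (h : p + (q - 1) = r) :
    IsLinearMap k fun y : Q.cochains q => brace x [⟨q, y⟩] r (by simpa using h) := by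
  have key : ∀ (A B : Q.Ob) (c : Q.Chain A B),
      IsLinearMap k fun y : Q.cochains q => braceRaw x [⟨q, y⟩] A B c := by
    intro A B c
    simp only [braceRaw, List.reverse_singleton, sum_insertions_cons]
    refine isLinearMap_list_sum _ _ fun s _ => isLinearMap_list_sum _ _ fun t _ =>
      isLinearMap_units_smul _ ?_
    simp only [insertions, List.map_cons, List.map_nil, List.sum_cons, List.sum_nil, add_zero,
      one_smul]
    have h1 := x.2.2 _ _ _ _ s.2.1 (t.2.1.bdeg + q) t.2.2
    exact ⟨fun y z => h1.map_add ⟨_, y.2.1 _ _ t.2.1⟩ ⟨_, z.2.1 _ _ t.2.1⟩,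
      fun a y => h1.map_smul a ⟨_, y.2.1 _ _ t.2.1⟩⟩
  exact ⟨fun y z => Subtype.ext <| funext fun A => funext fun B => funext fun c =>
      (key A B c).map_add y z, fun a y => Subtype.ext <| funext fun A => funext fun B =>
      funext fun c => (key A B c).map_smul a y⟩

lemma weight_append_cons {A B C D : Q.Ob} (c : Q.Chain A B) (d : ℤ) (f g : Q.gr B C d)
    (c' : Q.Chain C D) : (c.append (cons d f c')).weight = (c.append (cons d g c')).weight := by
  induction c with
  | nil => rfl
  | cons e h c ih => simp only [append, weight, deg_append, deg, ih f g]

/-- The sign `(-1)^{n i + (n - 1)|fₙ| + ⋯ + |f₂|}` that relates a cochain with `n` arguments and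
internal degree `i = p - n` to the corresponding bar cochain. -/
def suspSign (p : ℤ) {A B : Q.Ob} (c : Q.Chain A B) : ℤˣ :=
  (c.length * (p - c.length) + c.weight).negOnePow

/-- The passage between cochains and bar cochains; it is an involution. -/
def susp (p : ℤ) : Q.cochains p →ₗ[k] Q.cochains p where
  toFun φ := ⟨fun A B c => suspSign p c • φ.1 A B c, by
    refine ⟨fun A B c => ?_, fun A B C D c d c' => ?_⟩
    · change suspSign p c • φ.1 A B c ∈ _
      rw [Units.smul_def]
      exact zsmul_mem (φ.2.1 A B c) _
    · have h : ∀ f : Q.gr B C d, suspSign p (c.append (cons d f c')) =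
          suspSign p (c.append (cons d 0 c')) := fun f => by
        simp only [suspSign, length_append, length, weight_append_cons c d f 0 c']
      simp only [h]
      exact isLinearMap_units_smul _ (φ.2.2 _ _ _ _ c d c')⟩
  map_add' φ ψ := by ext A B c; simp
  map_smul' r φ := by ext A B c; simp [Units.smul_def, smul_comm r]

/-- The Hochschild differential `φ ↦ ⟨μ, φ⟩`, computed on bar cochains, for an `A_∞`-structure given
by a cochain `μ` of degree two. -/
def differential (μ : Q.cochains 2) (p q : ℤ) (h : p + 1 = q) : Q.cochains p →ₗ[k] Q.cochains q where
  toFun φ := susp q (bracket (susp 2 μ) (susp p φ) q (by linarith))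
  map_add' φ ψ := by
    simp only [bracket, map_add, (isLinearMap_brace_singleton _ _ (show 2 + (p - 1) = q by linarith)).map_add,
      brace_add, smul_add, map_sub]
    abel
  map_smul' r φ := by
    simp only [bracket, map_smul, (isLinearMap_brace_singleton _ _ (show 2 + (p - 1) = q by linarith)).map_smul, brace_smul,
      map_sub, Units.smul_def, RingHom.id_apply, smul_sub]
    simp only [smul_comm r, map_smul, map_zsmul]

/-- Hochschild cocycles of degree `p`. -/
def cocycles (μ : Q.cochains 2) (p : ℤ) : Submodule k (Q.cochains p) :=
  LinearMap.ker (differential μ p (p + 1) rfl)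

/-- Hochschild coboundaries of degree `p`. -/
def coboundaries (μ : Q.cochains 2) (p : ℤ) : Submodule k (Q.cochains p) :=
  LinearMap.range (differential μ (p - 1) p (sub_add_cancel p 1))

/-- Hochschild cohomology in degree `p`. -/
def HH (μ : Q.cochains 2) (p : ℤ) : Type _ :=
  cocycles μ p ⧸ (coboundaries μ p).submoduleOf (cocycles μ p)

instance (μ : Q.cochains 2) (p : ℤ) : AddCommGroup (HH μ p) :=
  inferInstanceAs (AddCommGroup (cocycles μ p ⧸ (coboundaries μ p).submoduleOf (cocycles μ p)))

instance (μ : Q.cochains 2) (p : ℤ) : Module k (HH μ p) :=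
  inferInstanceAs (Module k (cocycles μ p ⧸ (coboundaries μ p).submoduleOf (cocycles μ p)))

/-- The cohomology class of a cocycle. -/
def HH.mk (μ : Q.cochains 2) (p : ℤ) : cocycles μ p →ₗ[k] HH μ p := Submodule.mkQ _

/-- The projection `π₀` of a cochain to its part with no arguments. -/
def zeroPart (p : ℤ) : Q.cochains p →ₗ[k] ∀ A : Q.Ob, Q.gr A A p where
  toFun φ A := ⟨φ.1 A A (nil A), by simpa using φ.2.1 A A (nil A)⟩
  map_add' _ _ := rfl
  map_smul' _ _ := rfl

end GradedQuiver

open GradedQuiver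

section LinearCategory
variable (k : Type w) [CommRing k] (a : Type u) [Category.{v} a] [Preadditive a] [Linear k a]

/-- A `k`-linear category as a graded quiver concentrated in degree zero. -/
abbrev linQuiver : GradedQuiver.{w, v, u} k where
  Ob := a
  Hom X Y := X ⟶ Y
  gr _ _ d :=
    { carrier := {f | d ≠ 0 → f = 0}
      add_mem' := fun hf hg h => by rw [hf h, hg h, add_zero]
      zero_mem' := fun _ => rfl
      smul_mem' := fun r f hf h => by rw [hf h, smul_zero] }

/-- A precomplex in `a`: a graded object with an endomorphism of degree one. -/
structure Precomplex where
  X : ℤ → a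
  d : ∀ i j : ℤ, X i ⟶ X j
  shape : ∀ i j : ℤ, i + 1 ≠ j → d i j = 0

/-- The graded quiver of precomplexes in `a`, with the degree `n` part of `Hom(C, D)` being
`∏ p, a(C^p, D^{p+n})`. -/
abbrev precomplexQuiver : GradedQuiver.{w, v, max u v} k where
  Ob := Precomplex a
  Hom C D := ∀ i j : ℤ, C.X i ⟶ D.X j
  gr C D n :=
    { carrier := {f | ∀ i j : ℤ, i + n ≠ j → f i j = 0}
      add_mem' := fun hf hg i j h => by simp only [Pi.add_apply, hf i j h, hg i j h, add_zero]
      zero_mem' := fun _ _ _ => rfl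
      smul_mem' := fun r f hf i j h => by simp only [Pi.smul_apply, hf i j h, smul_zero] }

variable {k a}

/-- The morphism in a chain of length one, and zero on other chains. -/
def asMor : {X Y : (linQuiver k a).Ob} → (linQuiver k a).Chain X Y → (X ⟶ Y)
  | _, _, .cons _ f (.nil _) => f.1
  | _, _, .nil _ => 0
  | _, _, .cons _ _ (.cons _ _ _) => 0

/-- The composition of a chain of length two, and zero on other chains. -/
def asComp : {X Y : (linQuiver k a).Ob} → (linQuiver k a).Chain X Y → (X ⟶ Y)
  | _, _, .cons _ f c => f.1 ≫ asMor c
  | _, _, .nil _ => 0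

lemma asMor_mem {X Y : a} (c : (linQuiver k a).Chain X Y) (h : c.bdeg + 1 ≠ 0) : asMor c = 0 :=
  match c with
  | .cons d f (.nil _) => f.2 (by simpa using h)
  | .nil _ => rfl
  | .cons _ _ (.cons _ _ _) => rfl

lemma asComp_mem {X Y : a} (c : (linQuiver k a).Chain X Y) (h : c.bdeg + 2 ≠ 0) : asComp c = 0 :=
  match c with
  | .nil _ => rfl
  | .cons d f c => by
    by_cases hd : d = 0
    · have := asMor_mem c (fun he => h (by simp only [Chain.bdeg_cons, hd]; linarith))
      simp [asComp, this]
    · simp [asComp, f.2 hd]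

lemma asMor_linear {X Y Z W : a} (c : (linQuiver k a).Chain X Y) (d : ℤ)
    (c' : (linQuiver k a).Chain Z W) :
    IsLinearMap k fun f : (linQuiver k a).gr Y Z d => asMor (c.append (.cons d f c')) :=
  match c, c' with
  | .nil _, .nil _ => ⟨fun _ _ => rfl, fun _ _ => rfl⟩
  | .nil _, .cons _ _ _ => ⟨fun _ _ => (add_zero _).symm, fun _ _ => (smul_zero _).symm⟩
  | .cons _ _ (.nil _), _ => ⟨fun _ _ => (add_zero _).symm, fun _ _ => (smul_zero _).symm⟩
  | .cons _ _ (.cons _ _ _), _ => ⟨fun _ _ => (add_zero _).symm, fun _ _ => (smul_zero _).symm⟩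

lemma asComp_linear {X Y Z W : a} (c : (linQuiver k a).Chain X Y) (d : ℤ)
    (c' : (linQuiver k a).Chain Z W) :
    IsLinearMap k fun f : (linQuiver k a).gr Y Z d => asComp (c.append (.cons d f c')) :=
  match c with
  | .nil _ => ⟨fun f g => by simp [Chain.append, asComp],
      fun r f => by simp [Chain.append, asComp]⟩
  | .cons e g c => ⟨fun f h => by simp [Chain.append, asComp, (asMor_linear c d c').map_add],
      fun r f => by simp [Chain.append, asComp, (asMor_linear c d c').map_smul]⟩

variable (k a)

/-- The composition of `a` as a Hochschild cochain of degree two. -/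
def mult : (linQuiver k a).cochains 2 :=
  ⟨fun _ _ c => asComp c, fun _ _ c h => asComp_mem c h, fun _ _ _ _ c d c' => asComp_linear c d c'⟩

variable {k a}

/-- The index in the target reached by a chain of homogeneous maps of precomplexes from the index `p`
of the source. -/
def endIdx : {C D : (precomplexQuiver k a).Ob} → (precomplexQuiver k a).Chain C D → ℤ → ℤ
  | _, _, .nil _, p => p
  | _, _, .cons d _ c, p => endIdx c (p + d)

/-- The components of a chain of homogeneous maps of precomplexes along the indices from `p` on. -/
def path : {C D : (precomplexQuiver k a).Ob} → (c : (precomplexQuiver k a).Chain C D) → (p : ℤ) →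
    (linQuiver k a).Chain (C.X p) (D.X (endIdx c p))
  | C, _, .nil _, p => Chain.nil (Q := linQuiver k a) (C.X p)
  | _, _, .cons d f c, p => .cons 0 ⟨f.1 p (p + d), fun h => (h rfl).elim⟩ (path c (p + d))

lemma endIdx_eq {C D : (precomplexQuiver k a).Ob} (c : (precomplexQuiver k a).Chain C D) (p : ℤ) :
    endIdx c p = p + c.deg := by
  induction c generalizing p with
  | nil => simp [endIdx, Chain.deg]
  | cons d f c ih => simp [endIdx, Chain.deg, ih, add_assoc]

lemma bdeg_path {C D : (precomplexQuiver k a).Ob} (c : (precomplexQuiver k a).Chain C D) (p : ℤ) :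
    (path c p).bdeg = c.bdeg - c.deg := by
  induction c generalizing p with
  | nil C => exact (sub_self (0 : ℤ)).symm
  | cons d f c ih =>
    refine (Chain.bdeg_cons (Q := linQuiver k a) 0 _ (path c (p + d))).trans ?_
    rw [ih, Chain.bdeg_cons, Chain.deg]
    ring

/-- The values of `extend`. -/
def extendRaw {n : ℤ} (φ : (linQuiver k a).cochains n) : (precomplexQuiver k a).Raw :=
  fun _ D c p q => if h : endIdx c p = q then φ.1 _ _ (path c p) ≫ eqToHom (congrArg D.X h) else 0

lemma extendRaw_linear {n : ℤ} (φ : (linQuiver k a).cochains n) {C D E F : (precomplexQuiver k a).Ob}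
    (c : (precomplexQuiver k a).Chain C D) (d : ℤ) (c' : (precomplexQuiver k a).Chain E F)
    (p q : ℤ) (Y : a) (b : (linQuiver k a).Chain Y (C.X p)) :
    IsLinearMap k fun f : (precomplexQuiver k a).gr D E d =>
      (if h : endIdx (c.append (.cons d f c')) p = q then
        φ.1 _ _ (b.append (path (c.append (.cons d f c')) p)) ≫ eqToHom (congrArg F.X h)
      else 0 : Y ⟶ F.X q) := by
  induction c generalizing p Y with
  | nil C =>
    simp only [Chain.append, endIdx, path]
    by_cases h : endIdx c' (p + d) = q
    · simp only [h, ↓reduceDIte]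
      have h1 := φ.2.2 _ _ _ _ b 0 (path c' (p + d))
      exact ⟨fun f g => by
        rw [← Preadditive.add_comp, ← h1.map_add]; rfl, fun r f => by
        rw [← Linear.smul_comp, ← h1.map_smul]; rfl⟩
    · simp only [h, ↓reduceDIte]
      exact ⟨fun _ _ => (add_zero _).symm, fun _ _ => (smul_zero _).symm⟩
  | cons e g c ih =>
    have := ih (p + e) Y (b.append (.cons 0 ⟨g.1 p (p + e), fun h => (h rfl).elim⟩ (.nil _)))
    simpa only [Chain.append_assoc, Chain.append, endIdx, path] using this

/-- The canonical map `C(a) → C(PCom(a))`, applying a cochain componentwise. -/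
def extend (n : ℤ) : (linQuiver k a).cochains n →ₗ[k] (precomplexQuiver k a).cochains n where
  toFun φ := ⟨extendRaw φ, by
    refine ⟨fun C D c p q hpq => ?_, fun C D E F c d c' => ?_⟩
    · by_cases h : endIdx c p = q
      · have h0 : φ.1 _ _ (path c p) = 0 := φ.2.1 _ _ (path c p) (fun h' => hpq (by
          rw [bdeg_path] at h'
          rw [← h, endIdx_eq]
          linarith))
        simp [extendRaw, h0]
      · simp [extendRaw, h]
    · have := fun p q => extendRaw_linear φ c d c' p q _ (.nil _)
      exact ⟨fun f g => funext fun p => funext fun q => (this p q).map_add f g,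
        fun r f => funext fun p => funext fun q => (this p q).map_smul r f⟩⟩
  map_add' φ ψ := by
    ext C D c p q
    by_cases h : endIdx c p = q <;> simp [extendRaw, h]
  map_smul' r φ := by
    ext C D c p q
    by_cases h : endIdx c p = q <;> simp [extendRaw, h]

variable (k a)

/-- The element `δ` of degree one of `C(PCom(a))`: the predifferentials, with no arguments. -/
def differentialCochain : (precomplexQuiver k a).cochains 1 :=
  ⟨fun _ _ c => match c with
    | .nil C => C.d
    | .cons _ _ _ => 0, by
    refine ⟨fun C D c => ?_, fun C D E F c d c' => ?_⟩
    · match c with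
      | .nil C => exact fun i j h => C.shape i j (by simpa using h)
      | .cons _ _ _ => exact fun i j h => rfl
    · match c with
      | .nil C => exact ⟨fun _ _ => (add_zero _).symm, fun _ _ => (smul_zero _).symm⟩
      | .cons _ _ _ => exact ⟨fun _ _ => (add_zero _).symm, fun _ _ => (smul_zero _).symm⟩⟩

/-- The brace `φ{δ, …, δ}` with `m` entries `δ`, computed on bar cochains. -/
def braceDelta (n m : ℕ) (φ : (precomplexQuiver k a).cochains n) :
    (precomplexQuiver k a).cochains n :=
  susp n (brace (susp n φ) (List.replicate m ⟨1, susp 1 (differentialCochain k a)⟩) n (by simp))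

/-- The map `embr_δ : C(a) → C(PCom(a))`, `φ ↦ ∑ₘ φ{δ^{⊗ m}}`. A cochain of degree `n` on `a` has
`n` arguments, so that the terms with `m > n` vanish. -/
def embr (n : ℕ) : (linQuiver k a).cochains n →ₗ[k] (precomplexQuiver k a).cochains n where
  toFun φ := ∑ m ∈ Finset.range (n + 1), braceDelta k a n m (extend n φ)
  map_add' φ ψ := by
    simp only [map_add, braceDelta, brace_add, Finset.sum_add_distrib]
  map_smul' r φ := by
    simp only [map_smul, braceDelta, brace_smul, Finset.smul_sum, RingHom.id_apply]

open CochainComplex.HomComplex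

/-- The precomplex underlying a complex. -/
def toPrecomplex (C : CochainComplex a ℤ) : Precomplex a := ⟨C.X, C.d, fun i j h => C.shape i j h⟩

/-- The characteristic dg morphism (lifted characteristic morphism) in degree `n`: the component at the
complex `C` is the zero part at `C` of `embr_δ φ`. -/
def characteristicDg (n : ℕ) :
    (linQuiver k a).cochains n →ₗ[k] ∀ C : CochainComplex a ℤ, Cochain C C n where
  toFun φ C := Cochain.mk fun p q _ => (zeroPart _ (embr k a n φ) (toPrecomplex a C)).1 p q
  map_add' φ ψ := by
    ext C p q h
    simp only [map_add]
    rfl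
  map_smul' r φ := by
    ext C p q h
    simp only [map_smul, RingHom.id_apply]
    rfl

end LinearCategory

section LinearCategory
variable {k : Type w} [CommRing k] {a : Type u} [Category.{v} a] [Preadditive a] [Linear k a]

/-- The chain `X → Y`. -/
def chain₁ {X Y : a} (f : X ⟶ Y) : (linQuiver k a).Chain X Y :=
  .cons 0 ⟨f, fun h => (h rfl).elim⟩ (Chain.nil (Q := linQuiver k a) Y)

/-- The chain `X → Y → Z`. -/
def chain₂ {X Y Z : a} (f : X ⟶ Y) (g : Y ⟶ Z) : (linQuiver k a).Chain X Z :=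
  .cons 0 ⟨f, fun h => (h rfl).elim⟩ (chain₁ g)

/-- The chain `X → Y → Z → W`. -/
def chain₃ {X Y Z W : a} (f : X ⟶ Y) (g : Y ⟶ Z) (h : Z ⟶ W) : (linQuiver k a).Chain X W :=
  .cons 0 ⟨f, fun h => (h rfl).elim⟩ (chain₂ g h)

/-- The value `φ(g, f)` of a cochain on composable morphisms, the first morphism `f` being written first. -/
def app₂ (φ : (linQuiver k a).cochains 2) {X Y Z : a} (f : X ⟶ Y) (g : Y ⟶ Z) : X ⟶ Z :=
  φ.1 X Z (chain₂ f g)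

lemma cochain_zero {n : ℤ} (φ : (linQuiver k a).cochains n) {X Y Z W : a}
    (c : (linQuiver k a).Chain X Y) (d : ℤ) (hd : (0 : Y ⟶ Z) ∈ (linQuiver k a).gr Y Z d)
    (c' : (linQuiver k a).Chain Z W) :
    φ.1 _ _ (c.append (.cons d ⟨0, hd⟩ c')) = 0 :=
  (φ.2.2 _ _ _ _ c d c').map_zero

lemma app₂_left (φ : (linQuiver k a).cochains 2) {X Y Z : a} (f : X ⟶ Y) (g : Y ⟶ Z) (e : ℤ)
    (hf : f ∈ (linQuiver k a).gr X Y e) (hg : g ∈ (linQuiver k a).gr Y Z 0) (he : e = 0) :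
    φ.1 X Z (.cons e ⟨f, hf⟩ (.cons 0 ⟨g, hg⟩ (Chain.nil (Q := linQuiver k a) Z))) =
      app₂ φ f g := by
  subst he; rfl

lemma app₂_right (φ : (linQuiver k a).cochains 2) {X Y Z : a} (f : X ⟶ Y) (g : Y ⟶ Z) (e : ℤ)
    (hf : f ∈ (linQuiver k a).gr X Y 0) (hg : g ∈ (linQuiver k a).gr Y Z e) (he : e = 0) :
    φ.1 X Z (.cons 0 ⟨f, hf⟩ (.cons e ⟨g, hg⟩ (Chain.nil (Q := linQuiver k a) Z))) =
      app₂ φ f g := by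
  subst he; rfl

lemma differential_chain₃ (φ : (linQuiver k a).cochains 2) {X Y Z W : a}
    (f : X ⟶ Y) (g : Y ⟶ Z) (h : Z ⟶ W) :
    (differential (mult k a) 2 3 rfl φ).1 X W (chain₃ f g h) =
      f ≫ app₂ φ g h - app₂ φ (f ≫ g) h + app₂ φ f (g ≫ h) - app₂ φ f g ≫ h := by
  have z0 := fun {X Y Z : a} (d : ℤ) (hd : (0 : X ⟶ Y) ∈ (linQuiver k a).gr X Y d)
    (c' : (linQuiver k a).Chain Y Z) => cochain_zero φ (Chain.nil (Q := linQuiver k a) X) d hd c'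
  have z1 := fun {X Y Z W : a} (e : ℤ) (x : (linQuiver k a).gr X Y e) (d : ℤ)
    (hd : (0 : Y ⟶ Z) ∈ (linQuiver k a).gr Y Z d)
    (c' : (linQuiver k a).Chain Z W) =>
    cochain_zero φ (.cons e x (Chain.nil (Q := linQuiver k a) Y)) d hd c'
  have z2 := fun {X X' Y Z W : a} (e : ℤ) (x : (linQuiver k a).gr X X' e)
    (e' : ℤ) (x' : (linQuiver k a).gr X' Y e') (d : ℤ)
    (hd : (0 : Y ⟶ Z) ∈ (linQuiver k a).gr Y Z d)
    (c' : (linQuiver k a).Chain Z W) =>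
    cochain_zero φ (.cons e x (.cons e' x' (Chain.nil (Q := linQuiver k a) Y))) d hd c'
  have z3 := fun {X X' X'' Y Z W : a} (e : ℤ) (x : (linQuiver k a).gr X X' e)
    (e' : ℤ) (x' : (linQuiver k a).gr X' X'' e') (e'' : ℤ) (x'' : (linQuiver k a).gr X'' Y e'')
    (d : ℤ) (hd : (0 : Y ⟶ Z) ∈ (linQuiver k a).gr Y Z d)
    (c' : (linQuiver k a).Chain Z W) =>
    cochain_zero φ (.cons e x (.cons e' x' (.cons e'' x'' (Chain.nil (Q := linQuiver k a) Y))))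
      d hd c'
  simp only [Chain.append] at z0 z1 z2 z3
  simp [differential, susp, bracket, brace, braceRaw, insertions, chain₃, chain₂, chain₁,
    Chain.splits, suspSign, Chain.append, Chain.length, Chain.weight, Chain.deg, mult, asComp,
    asMor, z0, z1, z2, z3]
  rw [app₂_left _ f g _ _ _ (by rfl), app₂_left _ g h _ _ _ (by rfl),
    app₂_left _ (f ≫ g) h _ _ _ (by rfl), app₂_right _ f (g ≫ h) _ _ _ (by rfl)]
  abel

/-- The value of a cochain of degree one on a morphism. -/
def app₁ (ψ : (linQuiver k a).cochains 1) {X Y : a} (f : X ⟶ Y) : X ⟶ Y :=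
  ψ.1 X Y (chain₁ f)

lemma app₁_eq (φ : (linQuiver k a).cochains 1) {X Y : a} (f : X ⟶ Y) (e : ℤ)
    (hf : f ∈ (linQuiver k a).gr X Y e) (he : e = 0) :
    φ.1 X Y (.cons e ⟨f, hf⟩ (Chain.nil (Q := linQuiver k a) Y)) = app₁ φ f := by
  subst he; rfl

lemma differential_chain₂ (ψ : (linQuiver k a).cochains 1) {X Y Z : a}
    (f : X ⟶ Y) (g : Y ⟶ Z) :
    app₂ (differential (mult k a) 1 2 rfl ψ) f g =
      f ≫ app₁ ψ g - app₁ ψ (f ≫ g) + app₁ ψ f ≫ g := by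
  have z0 := fun {X Y Z : a} (d : ℤ) (hd : (0 : X ⟶ Y) ∈ (linQuiver k a).gr X Y d)
    (c' : (linQuiver k a).Chain Y Z) => cochain_zero ψ (Chain.nil (Q := linQuiver k a) X) d hd c'
  have z1 := fun {X Y Z W : a} (e : ℤ) (x : (linQuiver k a).gr X Y e) (d : ℤ)
    (hd : (0 : Y ⟶ Z) ∈ (linQuiver k a).gr Y Z d)
    (c' : (linQuiver k a).Chain Z W) =>
    cochain_zero ψ (.cons e x (Chain.nil (Q := linQuiver k a) Y)) d hd c'
  have z2 := fun {X X' Y Z W : a} (e : ℤ) (x : (linQuiver k a).gr X X' e)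
    (e' : ℤ) (x' : (linQuiver k a).gr X' Y e') (d : ℤ)
    (hd : (0 : Y ⟶ Z) ∈ (linQuiver k a).gr Y Z d)
    (c' : (linQuiver k a).Chain Z W) =>
    cochain_zero ψ (.cons e x (.cons e' x' (Chain.nil (Q := linQuiver k a) Y))) d hd c'
  simp only [Chain.append] at z0 z1 z2
  simp [differential, susp, bracket, brace, braceRaw, insertions, app₂, chain₂, chain₁,
    Chain.splits, suspSign, Chain.append, Chain.length, Chain.weight, Chain.deg, mult, asComp,
    asMor, z0, z1, z2]
  rw [app₁_eq _ f _ _ (by rfl), app₁_eq _ g _ _ (by rfl), app₁_eq _ (f ≫ g) _ _ (by rfl)]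
  abel

lemma characteristicDg_two (φ : (linQuiver k a).cochains 2) (C : CochainComplex a ℤ) (p q : ℤ)
    (h : p + 2 = q) :
    (characteristicDg k a 2 φ C).v p q h = -app₂ φ (C.d p (p + 1)) (C.d (p + 1) q) := by
  subst h
  change (embr k a 2 φ).1 _ _ _ p (p + 2) = _
  simp [embr, braceDelta, Finset.sum_range_succ, susp, brace, braceRaw, insertions, Chain.splits,
    suspSign, Chain.append, Chain.length, Chain.weight, Chain.deg, extend, extendRaw, endIdx, path]
  have key : ∀ (q : ℤ) (h : p + 1 + 1 = q),
      app₂ φ (C.d p (p + 1)) (C.d (p + 1) (p + 1 + 1)) ≫ eqToHom (congrArg C.X h) =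
        app₂ φ (C.d p (p + 1)) (C.d (p + 1) q) := by
    rintro _ rfl
    simp
  exact congrArg Neg.neg ((dif_pos (by ring)).trans (key _ (by ring)))

lemma app₂_add_left (φ : (linQuiver k a).cochains 2) {X Y Z : a} (f f' : X ⟶ Y) (g : Y ⟶ Z) :
    app₂ φ (f + f') g = app₂ φ f g + app₂ φ f' g :=
  (φ.2.2 _ _ _ _ (Chain.nil (Q := linQuiver k a) X) 0 (chain₁ g)).map_add
    ⟨f, fun h => (h rfl).elim⟩ ⟨f', fun h => (h rfl).elim⟩

lemma app₂_smul_left (φ : (linQuiver k a).cochains 2) {X Y Z : a} (r : k) (f : X ⟶ Y) (g : Y ⟶ Z) :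
    app₂ φ (r • f) g = r • app₂ φ f g :=
  (φ.2.2 _ _ _ _ (Chain.nil (Q := linQuiver k a) X) 0 (chain₁ g)).map_smul r
    ⟨f, fun h => (h rfl).elim⟩

lemma app₂_add_right (φ : (linQuiver k a).cochains 2) {X Y Z : a} (f : X ⟶ Y) (g g' : Y ⟶ Z) :
    app₂ φ f (g + g') = app₂ φ f g + app₂ φ f g' :=
  (φ.2.2 _ _ _ _ (chain₁ f) 0 (Chain.nil (Q := linQuiver k a) Z)).map_add
    ⟨g, fun h => (h rfl).elim⟩ ⟨g', fun h => (h rfl).elim⟩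

lemma app₂_smul_right (φ : (linQuiver k a).cochains 2) {X Y Z : a} (r : k) (f : X ⟶ Y)
    (g : Y ⟶ Z) : app₂ φ f (r • g) = r • app₂ φ f g :=
  (φ.2.2 _ _ _ _ (chain₁ f) 0 (Chain.nil (Q := linQuiver k a) Z)).map_smul r
    ⟨g, fun h => (h rfl).elim⟩

/-- `app₂` as a bilinear map. -/
def app₂Hom (φ : (linQuiver k a).cochains 2) (X Y Z : a) : (X ⟶ Y) →ₗ[k] (Y ⟶ Z) →ₗ[k] (X ⟶ Z) :=
  LinearMap.mk₂ k (app₂ φ) (app₂_add_left φ) (app₂_smul_left φ) (app₂_add_right φ)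
    (app₂_smul_right φ)

@[simp] lemma app₂_zero_left (φ : (linQuiver k a).cochains 2) {X Y Z : a} (g : Y ⟶ Z) :
    app₂ φ (0 : X ⟶ Y) g = 0 := LinearMap.map_zero₂ (app₂Hom φ X Y Z) g

@[simp] lemma app₂_zero_right (φ : (linQuiver k a).cochains 2) {X Y Z : a} (f : X ⟶ Y) :
    app₂ φ f (0 : Y ⟶ Z) = 0 := (app₂Hom φ X Y Z f).map_zero

lemma app₂_cocycle (φ : cocycles (mult k a) 2) {X Y Z W : a} (f : X ⟶ Y) (g : Y ⟶ Z)
    (h : Z ⟶ W) :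
    f ≫ app₂ φ.1 g h + app₂ φ.1 f (g ≫ h) = app₂ φ.1 (f ≫ g) h + app₂ φ.1 f g ≫ h := by
  have h1 := differential_chain₃ φ.1 f g h
  have h2 : differential (mult k a) 2 3 rfl φ.1 = 0 := φ.2
  rw [h2] at h1
  change 0 = _ at h1
  rw [← sub_eq_zero, h1]
  abel

end LinearCategory

section Deformation

variable {k : Type w} [CommRing k] {a : Type u} [Category.{v} a] [Preadditive a] [Linear k a]

/-- The first order deformation `a_φ[ε]` of `a` defined by a Hochschild cocycle `φ` of degree two. Its
objects are those of `a`, its morphisms are `a[ε]`, and its composition is `m + φ ε`. -/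
structure Deformation (φ : cocycles (mult k a) 2) where
  of : a

namespace Deformation

variable {φ : cocycles (mult k a) 2}

/-- Morphisms `f₀ + f₁ ε` of the deformation. -/
structure Hom (X Y : Deformation φ) where
  coeff₀ : X.of ⟶ Y.of
  coeff₁ : X.of ⟶ Y.of

lemma app₂_id_left {X Y : a} (f : X ⟶ Y) : app₂ φ.1 (𝟙 X) f = app₂ φ.1 (𝟙 X) (𝟙 X) ≫ f := by
  have := app₂_cocycle φ (𝟙 X) (𝟙 X) f
  simp only [Category.id_comp] at this
  rw [add_comm] at this
  exact add_left_cancel this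

lemma app₂_id_right {X Y : a} (f : X ⟶ Y) : app₂ φ.1 f (𝟙 Y) = f ≫ app₂ φ.1 (𝟙 Y) (𝟙 Y) := by
  have := app₂_cocycle φ f (𝟙 Y) (𝟙 Y)
  simp only [Category.comp_id] at this
  rw [add_comm] at this
  exact (add_left_cancel this).symm

instance : Category (Deformation φ) where
  Hom := Hom
  id X := ⟨𝟙 X.of, -app₂ φ.1 (𝟙 X.of) (𝟙 X.of)⟩
  comp f g := ⟨f.coeff₀ ≫ g.coeff₀,
    f.coeff₀ ≫ g.coeff₁ + f.coeff₁ ≫ g.coeff₀ + app₂ φ.1 f.coeff₀ g.coeff₀⟩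
  id_comp f := by
    simp [app₂_id_left f.coeff₀]
  comp_id f := by
    simp [app₂_id_right f.coeff₀]
  assoc f g h := by
    simp only [Category.assoc, Hom.mk.injEq, true_and, Preadditive.comp_add, Preadditive.add_comp]
    have := app₂_cocycle φ f.coeff₀ g.coeff₀ h.coeff₀
    rw [← sub_eq_zero] at this ⊢
    rw [← neg_eq_zero, ← this]
    abel

@[ext] lemma hom_ext {X Y : Deformation φ} {f g : X ⟶ Y} (h₀ : f.coeff₀ = g.coeff₀)
    (h₁ : f.coeff₁ = g.coeff₁) : f = g := by
  change Hom X Y at f g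
  cases f; cases g; cases h₀; cases h₁; rfl

@[simp] lemma id_coeff₀ (X : Deformation φ) : (𝟙 X : X ⟶ X).coeff₀ = 𝟙 X.of := rfl
@[simp] lemma id_coeff₁ (X : Deformation φ) :
    (𝟙 X : X ⟶ X).coeff₁ = -app₂ φ.1 (𝟙 X.of) (𝟙 X.of) := rfl
@[simp] lemma comp_coeff₀ {X Y Z : Deformation φ} (f : X ⟶ Y) (g : Y ⟶ Z) :
    (f ≫ g).coeff₀ = f.coeff₀ ≫ g.coeff₀ := rfl
@[simp] lemma comp_coeff₁ {X Y Z : Deformation φ} (f : X ⟶ Y) (g : Y ⟶ Z) :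
    (f ≫ g).coeff₁ = f.coeff₀ ≫ g.coeff₁ + f.coeff₁ ≫ g.coeff₀ + app₂ φ.1 f.coeff₀ g.coeff₀ := rfl

instance (X Y : Deformation φ) : Zero (X ⟶ Y) := ⟨⟨0, 0⟩⟩

instance (X Y : Deformation φ) : Add (X ⟶ Y) :=
  ⟨fun f g => ⟨f.coeff₀ + g.coeff₀, f.coeff₁ + g.coeff₁⟩⟩

instance (X Y : Deformation φ) : Neg (X ⟶ Y) := ⟨fun f => ⟨-f.coeff₀, -f.coeff₁⟩⟩

instance (X Y : Deformation φ) : AddCommGroup (X ⟶ Y) where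
  add_assoc _ _ _ := hom_ext (add_assoc _ _ _) (add_assoc _ _ _)
  zero_add _ := hom_ext (zero_add _) (zero_add _)
  add_zero _ := hom_ext (add_zero _) (add_zero _)
  neg_add_cancel _ := hom_ext (neg_add_cancel _) (neg_add_cancel _)
  add_comm _ _ := hom_ext (add_comm _ _) (add_comm _ _)
  nsmul := nsmulRec
  zsmul := zsmulRec

@[simp] lemma add_coeff₀ {X Y : Deformation φ} (f g : X ⟶ Y) :
    (f + g).coeff₀ = f.coeff₀ + g.coeff₀ := rfl
@[simp] lemma add_coeff₁ {X Y : Deformation φ} (f g : X ⟶ Y) :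
    (f + g).coeff₁ = f.coeff₁ + g.coeff₁ := rfl
@[simp] lemma zero_coeff₀ (X Y : Deformation φ) : (0 : X ⟶ Y).coeff₀ = 0 := rfl
@[simp] lemma zero_coeff₁ (X Y : Deformation φ) : (0 : X ⟶ Y).coeff₁ = 0 := rfl
@[simp] lemma neg_coeff₀ {X Y : Deformation φ} (f : X ⟶ Y) : (-f).coeff₀ = -f.coeff₀ := rfl
@[simp] lemma neg_coeff₁ {X Y : Deformation φ} (f : X ⟶ Y) : (-f).coeff₁ = -f.coeff₁ := rfl

instance : Preadditive (Deformation φ) where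
  add_comp _ _ _ f f' g := by
    ext <;> simp [app₂_add_left]
    abel
  comp_add _ _ _ f g g' := by
    ext <;> simp [app₂_add_right]
    abel

instance (X Y : Deformation φ) : Module (DualNumber k) (X ⟶ Y) where
  smul r f := ⟨r.fst • f.coeff₀, r.fst • f.coeff₁ + r.snd • f.coeff₀⟩
  one_smul f := hom_ext (one_smul _ _) (by
    change (1 : k) • _ + (0 : k) • _ = _
    rw [one_smul, zero_smul, add_zero])
  mul_smul r s f := hom_ext (mul_smul r.fst s.fst f.coeff₀) (by
    change (r.fst * s.fst) • f.coeff₁ + (r * s).snd • f.coeff₀ =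
      r.fst • (s.fst • f.coeff₁ + s.snd • f.coeff₀) + r.snd • s.fst • f.coeff₀
    rw [DualNumber.snd_mul]
    module)
  smul_zero r := hom_ext (smul_zero _) (by
    change r.fst • (0 : X.of ⟶ Y.of) + r.snd • (0 : X.of ⟶ Y.of) = 0
    simp)
  smul_add r f g := hom_ext (smul_add _ _ _) (by
    change r.fst • (f.coeff₁ + g.coeff₁) + r.snd • (f.coeff₀ + g.coeff₀) =
      (r.fst • f.coeff₁ + r.snd • f.coeff₀) + (r.fst • g.coeff₁ + r.snd • g.coeff₀)
    module)
  add_smul r s f := hom_ext (add_smul r.fst s.fst f.coeff₀) (by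
    change (r.fst + s.fst) • f.coeff₁ + (r.snd + s.snd) • f.coeff₀ =
      (r.fst • f.coeff₁ + r.snd • f.coeff₀) + (s.fst • f.coeff₁ + s.snd • f.coeff₀)
    module)
  zero_smul f := hom_ext (zero_smul k _) (by
    change (0 : k) • _ + (0 : k) • _ = _
    simp)

@[simp] lemma smul_coeff₀ {X Y : Deformation φ} (r : DualNumber k) (f : X ⟶ Y) :
    (r • f).coeff₀ = r.fst • f.coeff₀ := rfl
@[simp] lemma smul_coeff₁ {X Y : Deformation φ} (r : DualNumber k) (f : X ⟶ Y) :
    (r • f).coeff₁ = r.fst • f.coeff₁ + r.snd • f.coeff₀ := rfl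

instance : Linear (DualNumber k) (Deformation φ) where
  smul_comp _ _ _ r f g := by
    ext <;> simp [app₂_smul_left]
    abel
  comp_smul _ _ _ f r g := by
    ext <;> simp [app₂_smul_right]
    abel

variable (φ)

/-- The reduction `k ⊗_{k[ε]} a_φ[ε] → a` modulo `ε`. -/
def reduction : Deformation φ ⥤ a where
  obj X := X.of
  map f := f.coeff₀

instance : (reduction φ).Additive where

end Deformation

/-- A lift of the differential of a complex `C` to a predifferential over `a_φ[ε]` on the same graded
object, not required to square to zero. -/
structure GradedLift (φ : cocycles (mult k a) 2) (C : CochainComplex a ℤ) where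
  d : ∀ i j : ℤ, (⟨C.X i⟩ : Deformation φ) ⟶ ⟨C.X j⟩
  shape : ∀ i j : ℤ, i + 1 ≠ j → d i j = 0
  reduction_d : ∀ i j : ℤ, (Deformation.reduction φ).map (d i j) = C.d i j

open CochainComplex.HomComplex

namespace GradedLift
variable {φ : cocycles (mult k a) 2} {C : CochainComplex a ℤ}

/-- The curvature `-(d ∘ d)` of a graded lift. -/
def curvature (L : GradedLift φ C) (p q : ℤ) : (⟨C.X p⟩ : Deformation φ) ⟶ ⟨C.X q⟩ :=
  -(L.d p (p + 1) ≫ L.d (p + 1) q)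

lemma reduction_curvature (L : GradedLift φ C) (p q : ℤ) :
    (Deformation.reduction φ).map (L.curvature p q) = 0 := by
  rw [curvature, Functor.map_neg, Functor.map_comp, L.reduction_d, L.reduction_d]
  exact neg_eq_zero.2 (C.d_comp_d p (p + 1) q)

/-- The curvature of a graded lift is `u ε` for a cocycle `u` of degree two in the complex of
endomorphisms of `C`. -/
def cocycle (L : GradedLift φ C) : Cocycle C C 2 :=
  Cocycle.mk (Cochain.mk fun p q _ => (L.curvature p q).coeff₁) 3 (by norm_num) (by
    ext p q h
    have hD : ∀ i j, (L.d i j).coeff₀ = C.d i j := L.reduction_d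
    have hE : ∀ i j l, (L.d i j ≫ L.d j l).coeff₀ = 0 := fun i j l => by
      rw [Deformation.comp_coeff₀, hD, hD]
      exact C.d_comp_d i j l
    have key : (L.d p (p + 1) ≫ L.d (p + 1) (p + 1 + 1)).coeff₁ ≫ C.d (p + 1 + 1) q =
        C.d p (p + 1) ≫ (L.d (p + 1) (p + 1 + 1) ≫ L.d (p + 1 + 1) q).coeff₁ := by
      have h₁ := Deformation.comp_coeff₁ (L.d p (p + 1) ≫ L.d (p + 1) (p + 1 + 1))
        (L.d (p + 1 + 1) q)
      have h₂ := Deformation.comp_coeff₁ (L.d p (p + 1))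
        (L.d (p + 1) (p + 1 + 1) ≫ L.d (p + 1 + 1) q)
      rw [hE, hD] at h₁ h₂
      rw [Category.assoc, h₂] at h₁
      simpa using h₁.symm
    rw [δ_v 2 3 (by norm_num) _ p q h (p + 1 + 1) (p + 1) (by omega) rfl]
    simp only [Cochain.mk_v, curvature, Deformation.neg_coeff₁, Preadditive.neg_comp,
      Preadditive.comp_neg, key, Int.negOnePow_odd 3 (by decide), Cochain.zero_v, Units.neg_smul, one_smul]
    abel)

end GradedLift

end Deformation

section Centre
variable (k : Type w) [CommRing k] (T : Type u) [Category.{v} T] [Preadditive T] [Linear k T]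
  [HasShift T ℤ] [∀ n : ℤ, (shiftFunctor T n).Additive] [∀ n : ℤ, (shiftFunctor T n).Linear k]

/-- The degree `n` part of the graded centre of a `k`-linear category with shift: families
`ζ_X : X → X[n]` with `ζ_Y f = (-1)^{|f| n} f ζ_X` for all `f : X → Y[m]`, `|f| = m`. -/
def gradedCentre (n : ℤ) : Submodule k (∀ X : T, ShiftedHom X X n) where
  carrier := {ζ | ∀ (m : ℤ) (X Y : T) (f : ShiftedHom X Y m),
    f.comp (ζ Y) (add_comm n m) = (m * n).negOnePow • (ζ X).comp f rfl}
  add_mem' hζ hξ m X Y f := by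
    simp only [Pi.add_apply, ShiftedHom.comp_add, ShiftedHom.add_comp, hζ m X Y f, hξ m X Y f,
      smul_add]
  zero_mem' m X Y f := by simp
  smul_mem' r ζ hζ m X Y f := by
    simp only [Pi.smul_apply, ShiftedHom.comp_smul, ShiftedHom.smul_comp, hζ m X Y f,
      Units.smul_def]
    rw [smul_comm]

end Centre

section Characteristic

variable (k : Type w) [CommRing k] {a : Type u} [Category.{v} a] [Preadditive a] [Linear k a]

open CochainComplex.HomComplex

lemma equivHomShift_symm_f {K L : CochainComplex a ℤ} {n : ℤ} (z : Cocycle K L n) (p : ℤ) :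
    (Cocycle.equivHomShift.symm z).f p = z.1.v p (p + n) rfl :=
  (Cochain.rightShift_v z.1 n 0 (zero_add n) p p (by simp) _ rfl).trans
    (Category.comp_id _)

lemma v_comp_XIsoOfEq {K L : CochainComplex a ℤ} {n : ℤ} (z : Cochain K L n) (p q q' : ℤ)
    (h : p + n = q) (h' : q = q') :
    z.v p q h ≫ (L.XIsoOfEq h').hom = z.v p q' (h.trans h') := by
  subst h'
  simp

/-- The morphism `K → L[n]` in the homotopy category defined by a cocycle of degree `n`. -/
def homClass (K L : CochainComplex a ℤ) (n : ℤ) :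
    Cocycle K L n →ₗ[k] ShiftedHom ((HomotopyCategory.quotient a (.up ℤ)).obj K)
      ((HomotopyCategory.quotient a (.up ℤ)).obj L) n where
  toFun z := ShiftedHom.map (Cocycle.equivHomShift.symm z) (HomotopyCategory.quotient a (.up ℤ))
  map_add' z w := by rw [map_add]; exact ShiftedHom.map_add _ _ _
  map_smul' r z := by
    rw [RingHom.id_apply, ← ShiftedHom.map_smul]
    congr 1
    ext p
    change (Cocycle.equivHomShift.symm (r • z)).f p = r • (Cocycle.equivHomShift.symm z).f p
    rw [equivHomShift_symm_f, equivHomShift_symm_f]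
    rfl

variable {k}

lemma homClass_surjective (K L : CochainComplex a ℤ) (n : ℤ) :
    Function.Surjective (homClass k K L n) := fun f => by
  obtain ⟨g, hg⟩ := (HomotopyCategory.quotient a (.up ℤ)).map_surjective
    (f ≫ ((HomotopyCategory.quotient a (.up ℤ)).commShiftIso n).inv.app L)
  refine ⟨Cocycle.equivHomShift g, ?_⟩
  change ShiftedHom.map (Cocycle.equivHomShift.symm _) _ = f
  rw [AddEquiv.symm_apply_apply, ShiftedHom.map, hg]
  simp

lemma homClass_eq_zero (K L : CochainComplex a ℤ) (n m : ℤ) (hm : m + 1 = n) (z : Cocycle K L n)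
    (β : Cochain K L m) (h : δ m n β = z) : homClass k K L n z = 0 := by
  have := (CohomologyClass.toHom_mk_eq_zero_iff z).2 ((mem_coboundaries_iff z m hm).2 ⟨β, h⟩)
  rw [CohomologyClass.toHom_mk] at this
  change (HomotopyCategory.quotient a (.up ℤ)).map (Cocycle.equivHomShift.symm z) ≫ _ = 0
  rw [this, Limits.zero_comp]

lemma homClass_comp (K L M : CochainComplex a ℤ) (n m l : ℤ) (h : n + m = l) (z : Cocycle K L n)
    (w : Cocycle L M m) (y : Cocycle K M l) (hy : (y : Cochain K M l) = (z : Cochain K L n).comp w h) :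
    (homClass k K L n z).comp (homClass k L M m w) (by omega) = homClass k K M l y := by
  have : (ShiftedHom.comp (Cocycle.equivHomShift.symm z : ShiftedHom K L n)
      (Cocycle.equivHomShift.symm w : ShiftedHom L M m) (by omega)) =
      (Cocycle.equivHomShift.symm y : ShiftedHom K M l) := by
    ext p
    rw [equivHomShift_symm_f, hy, Cochain.comp_v _ _ h p (p + n) (p + l) rfl (by omega)]
    dsimp [ShiftedHom.comp]
    erw [equivHomShift_symm_f, equivHomShift_symm_f, CochainComplex.shiftFunctorAdd'_inv_app_f',
      v_comp_XIsoOfEq]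
  have e := congrArg (fun x => ShiftedHom.map x (HomotopyCategory.quotient a (.up ℤ))) this
  exact (ShiftedHom.map_comp _ _ _ _).symm.trans e

/-- The graded lift `d + 0 ε`. -/
def GradedLift.trivial (φ : cocycles (mult k a) 2) (C : CochainComplex a ℤ) : GradedLift φ C where
  d i j := ⟨C.d i j, 0⟩
  shape i j h := Deformation.hom_ext (C.shape i j h) rfl
  reduction_d _ _ := rfl

lemma characteristicDg_eq_cocycle (φ : cocycles (mult k a) 2) (C : CochainComplex a ℤ) :
    characteristicDg k a 2 φ.1 C = ((GradedLift.trivial φ C).cocycle : Cochain C C 2) := by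
  ext p q h
  rw [characteristicDg_two]
  simp [GradedLift.cocycle, GradedLift.curvature, GradedLift.trivial]

/-- The image of a Hochschild cocycle under the characteristic dg morphism is a cocycle. -/
def charCocycle (φ : cocycles (mult k a) 2) (C : CochainComplex a ℤ) : Cocycle C C 2 :=
  Cocycle.mk (characteristicDg k a 2 φ.1 C) 3 (by norm_num) (by
    rw [characteristicDg_eq_cocycle]
    exact Cocycle.δ_eq_zero _ _)

lemma charCocycle_v (φ : cocycles (mult k a) 2) (C : CochainComplex a ℤ) (p q r : ℤ)
    (hq : p + 1 = q) (h : p + 2 = r) :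
    (charCocycle φ C : Cochain C C 2).v p r h = -app₂ φ.1 (C.d p q) (C.d q r) := by
  subst hq
  exact characteristicDg_two φ.1 C p r h

/-- The composition of cocycles. -/
def compCocycle {K L M : CochainComplex a ℤ} {n m : ℤ} (l : ℤ) (h : n + m = l) (z : Cocycle K L n)
    (w : Cocycle L M m) : Cocycle K M l :=
  Cocycle.mk ((z : Cochain K L n).comp w h) (l + 1) rfl (by
    rw [δ_comp _ _ h (n + 1) (m + 1) (l + 1) rfl rfl rfl]
    simp)

lemma app₂_neg_left (φ : (linQuiver k a).cochains 2) {X Y Z : a} (f : X ⟶ Y) (g : Y ⟶ Z) :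
    app₂ φ (-f) g = -app₂ φ f g := LinearMap.map_neg₂ (app₂Hom φ X Y Z) f g

lemma app₂_neg_right (φ : (linQuiver k a).cochains 2) {X Y Z : a} (f : X ⟶ Y) (g : Y ⟶ Z) :
    app₂ φ f (-g) = -app₂ φ f g := (app₂Hom φ X Y Z f).map_neg g

lemma homotopy_identity (φ : cocycles (mult k a) 2) {X X' X'' Y Y' Y'' : a}
    (d₁ : X ⟶ X') (d₂ : X' ⟶ X'') (e₁ : Y ⟶ Y') (e₂ : Y' ⟶ Y'') (f : X ⟶ Y) (f' : X' ⟶ Y')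
    (f'' : X'' ⟶ Y'') (s : ℤˣ) (hd : d₁ ≫ d₂ = 0) (he : e₁ ≫ e₂ = 0)
    (h : f ≫ e₁ = s • d₁ ≫ f') (h' : f' ≫ e₂ = s • d₂ ≫ f'') :
    (app₂ φ.1 f e₁ - s • app₂ φ.1 d₁ f') ≫ e₂ +
      s • d₁ ≫ (app₂ φ.1 f' e₂ - s • app₂ φ.1 d₂ f'') =
      f ≫ app₂ φ.1 e₁ e₂ - app₂ φ.1 d₁ d₂ ≫ f'' := by
  have h₁ := app₂_cocycle φ f e₁ e₂
  have h₂ := app₂_cocycle φ d₁ f' e₂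
  have h₃ := app₂_cocycle φ d₁ d₂ f''
  rw [he, app₂_zero_right, add_zero] at h₁
  rw [hd, app₂_zero_left, zero_add] at h₃
  rw [← h₃, h₁]
  rw [h, h'] at *
  rw [← sub_eq_zero] at h₂
  rcases Int.units_eq_one_or s with rfl | rfl
  · simp only [one_smul, Preadditive.sub_comp, Preadditive.comp_sub] at h₂ ⊢
    rw [← sub_eq_zero, ← h₂]
    abel
  · simp only [Units.neg_smul, one_smul, Preadditive.sub_comp, Preadditive.comp_sub,
      Preadditive.comp_neg, Preadditive.neg_comp, app₂_neg_left, app₂_neg_right] at h₂ ⊢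
    rw [← sub_eq_zero, ← neg_eq_zero, ← h₂]
    abel

lemma charCocycle_comm (φ : cocycles (mult k a) 2) (C D : CochainComplex a ℤ) (m : ℤ)
    (f : Cocycle C D m) :
    (homClass k C D m f).comp (homClass k D D 2 (charCocycle φ D)) (add_comm 2 m) =
      (m * 2).negOnePow • (homClass k C C 2 (charCocycle φ C)).comp (homClass k C D m f) rfl := by
  have hs : (m * 2).negOnePow = 1 := Int.negOnePow_even _ ⟨m, by ring⟩
  rw [hs, one_smul, homClass_comp C D D m 2 (m + 2) rfl f (charCocycle φ D)
      (compCocycle (m + 2) rfl f (charCocycle φ D)) rfl,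
    homClass_comp C C D 2 m (m + 2) (add_comm _ _) (charCocycle φ C) f
      (compCocycle (m + 2) (add_comm _ _) (charCocycle φ C) f) rfl, ← sub_eq_zero, ← map_sub]
  let H : Cochain C D (m + 1) := Cochain.mk fun p q _ =>
    app₂ φ.1 (f.1.v p (p + m) rfl) (D.d (p + m) q) -
      m.negOnePow • app₂ φ.1 (C.d p (p + 1)) (f.1.v (p + 1) q (by omega))
  have hf : ∀ p q p' q' (h : p + m = q) (h' : p' + m = q') (hp : p + 1 = p'),
      f.1.v p q h ≫ D.d q q' = m.negOnePow • C.d p p' ≫ f.1.v p' q' h' := by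
    intro p q p' q' h h' hp
    have := congrArg (fun z => z.v p q' (by omega : p + (m + 1) = q'))
      (Cocycle.δ_eq_zero f (m + 1))
    simp only [δ_v m (m + 1) rfl f.1 p q' (by omega) q p' (by omega) hp, Cochain.zero_v,
      Int.negOnePow_succ, Units.neg_smul] at this
    rwa [← sub_eq_add_neg, sub_eq_zero] at this
  refine homClass_eq_zero C D (m + 2) (m + 1) (by ring) _ (-H) ?_
  rw [δ_neg]
  ext p q h
  rw [Cochain.neg_v, δ_v (m + 1) (m + 2) (by ring) H p q h (p + (m + 1)) (p + 1) (by omega) rfl]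
  change _ = ((f : Cochain C D m).comp (charCocycle φ D : Cochain D D 2) rfl).v p q h -
    ((charCocycle φ C : Cochain C C 2).comp (f : Cochain C D m) (add_comm _ _)).v p q h
  rw [Cochain.comp_v _ _ rfl p (p + m) q rfl (by omega),
    Cochain.comp_v _ _ (add_comm 2 m) p (p + 1 + 1) q (by omega) (by omega),
    charCocycle_v φ D (p + m) (p + (m + 1)) q (by omega) (by omega),
    charCocycle_v φ C p (p + 1) (p + 1 + 1) rfl (by omega)]
  have key := homotopy_identity φ (C.d p (p + 1)) (C.d (p + 1) (p + 1 + 1))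
    (D.d (p + m) (p + (m + 1))) (D.d (p + (m + 1)) q) (f.1.v p (p + m) rfl)
    (f.1.v (p + 1) (p + (m + 1)) (by omega)) (f.1.v (p + 1 + 1) q (by omega)) m.negOnePow
    (C.d_comp_d _ _ _) (D.d_comp_d _ _ _) (hf _ _ _ _ _ _ (by omega)) (hf _ _ _ _ _ _ (by omega))
  have hm : (m + 2).negOnePow = m.negOnePow := by
    rw [Int.negOnePow_add, Int.negOnePow_even 2 ⟨1, rfl⟩, mul_one]
  have hH : H.v (p + 1) q (by omega) = app₂ φ.1 (f.1.v (p + 1) (p + (m + 1)) (by omega))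
      (D.d (p + (m + 1)) q) - m.negOnePow • app₂ φ.1 (C.d (p + 1) (p + 1 + 1))
        (f.1.v (p + 1 + 1) q (by omega)) := by
    have : ∀ x (hx : p + 1 + m = x), app₂ φ.1 (f.1.v (p + 1) (p + 1 + m) rfl)
        (D.d (p + 1 + m) q) = app₂ φ.1 (f.1.v (p + 1) x hx) (D.d x q) := by
      rintro _ rfl; rfl
    simp only [H, Cochain.mk_v, this (p + (m + 1)) (by omega)]
  rw [hm, hH]
  simp only [H, Cochain.mk_v]
  rw [key, Preadditive.comp_neg, Preadditive.neg_comp]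
  abel

lemma charCocycle_eq_zero (φ : cocycles (mult k a) 2)
    (hφ : φ.1 ∈ coboundaries (mult k a) 2) (C : CochainComplex a ℤ) :
    homClass k C C 2 (charCocycle φ C) = 0 := by
  obtain ⟨ψ, hψ⟩ := hφ
  change (linQuiver k a).cochains 1 at ψ
  change differential (mult k a) 1 2 rfl ψ = φ.1 at hψ
  refine homClass_eq_zero C C 2 1 rfl _ (-Cochain.mk fun p q _ => app₁ ψ (C.d p q)) ?_
  have h0 : ∀ X Y : a, app₁ ψ (0 : X ⟶ Y) = 0 := fun X Y =>
    cochain_zero ψ (Chain.nil (Q := linQuiver k a) X) 0 _ (Chain.nil (Q := linQuiver k a) Y)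
  rw [δ_neg]
  ext p q h
  rw [Cochain.neg_v, δ_v 1 2 rfl _ p q h (p + 1) (p + 1) (by omega) rfl,
    charCocycle_v φ C p (p + 1) q rfl h, ← hψ, differential_chain₂, C.d_comp_d, h0]
  simp only [Cochain.mk_v, Int.negOnePow_even 2 ⟨1, rfl⟩, one_smul]
  abel

/-- The characteristic morphism on Hochschild cocycles. -/
def characteristicCocycles :
    cocycles (mult k a) 2 →ₗ[k] gradedCentre k (HomotopyCategory a (.up ℤ)) 2 where
  toFun φ := ⟨fun C => homClass k C.as C.as 2 (charCocycle φ C.as), fun m X Y f => by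
    obtain ⟨z, rfl⟩ := homClass_surjective (k := k) X.as Y.as m f
    exact charCocycle_comm φ X.as Y.as m z⟩
  map_add' φ ψ := by
    ext C
    change _ = homClass k C.as C.as 2 _ + homClass k C.as C.as 2 _
    rw [← map_add]
    change homClass k C.as C.as 2 _ = _
    congr 1
    ext p q h
    change (characteristicDg k a 2 (φ.1 + ψ.1) C.as).v p q h = _
    rw [map_add]
    rfl
  map_smul' r φ := by
    ext C
    change _ = r • homClass k C.as C.as 2 _
    rw [← map_smul]
    change homClass k C.as C.as 2 _ = _
    congr 1
    ext p q h
    change (characteristicDg k a 2 (r • φ.1) C.as).v p q h = _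
    rw [map_smul]
    rfl

/-- The characteristic morphism `χ_a : HH²(a) → 𝔷²K(a)`, induced on cohomology by the characteristic dg
morphism. -/
def characteristicMorphism :
    HH (mult k a) 2 →ₗ[k] gradedCentre k (HomotopyCategory a (.up ℤ)) 2 :=
  Submodule.liftQ _ characteristicCocycles fun φ hφ => by
    refine Subtype.ext (funext fun C => ?_)
    exact charCocycle_eq_zero φ hφ C.as

/-- The obstruction class in `K(a)(C, C[2])` of a graded lift: the class of the cocycle `u` for which
the curvature of the graded lift is `u ε`. -/
def GradedLift.obstruction {φ : cocycles (mult k a) 2} {C : CochainComplex a ℤ}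
    (L : GradedLift φ C) :
    ShiftedHom ((HomotopyCategory.quotient a (.up ℤ)).obj C)
      ((HomotopyCategory.quotient a (.up ℤ)).obj C) (2 : ℤ) :=
  homClass k C C 2 L.cocycle

end Characteristic

end HochChar

end

/-! On degree two cochains the only term of `embr` without arguments is φ{δ, δ}. The terms with
fewer δ's vanish because a degree two cochain on a quiver concentrated in degree 0 takes exactly two
arguments. Passing to shifted maps costs (-1)^{|f₂|} with f₂ = δ of degree one, and this is the
minus sign in -φ(δ, δ).

The rest is a computation with square-zero perturbations. A graded lift of (C, d) is d + βε with β
an arbitrary cochain of degree one. In the deformed composition m + φε its square is (dβ + βd + φ(d,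
d))ε, since d² = 0. The curvature is therefore uε with u = -φ(d, d) - δβ, where δ is now the
differential of the complex of endomorphisms of C. So u is the lifted characteristic cocycle up to
the coboundary of the perturbation (`GradedLift.cocycle_eq`). Its class does not see β and equals
χ(c)_C (`GradedLift.obstruction_eq`).

If χ(c)_C = 0, then -φ(d, d) = δβ for some β, because a cocycle is zero in K(a) exactly when it is a
coboundary (`homClass_eq_zero_iff`). This β makes d + βε square to zero, so C lifts on the nose, as
a complex and not only up to homotopy (`exists_lift_of_homClass_eq_zero`).

Conversely, a complex D over the deformation is a graded lift of its own reduction with zero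
curvature, so χ(c) vanishes at that reduction (`homClass_reduction_eq_zero`). The reduction is only
isomorphic to C in K(a). The gap is closed by centrality: a family in the graded centre commutes
with isomorphisms, so its vanishing at an object depends only on the isomorphism class
(`gradedCentre_eq_zero_of_iso`). -/

namespace HochChar

open CochainComplex.HomComplex

/-! ### Cocycles with zero class in the homotopy category -/

section

variable {k : Type w} [CommRing k] {a : Type u} [Category.{v} a] [Preadditive a] [Linear k a]

/-- `homClass` is the homotopy class of the chain map K → L[n] attached to z, followed by the
isomorphism that commutes the quotient functor with the shift. Cancelling that isomorphism leaves
the statement that a cocycle is null-homotopic exactly when it is a coboundary. The implication from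
left to right is what produces a perturbation from a vanishing class. -/
lemma homClass_eq_zero_iff (K L : CochainComplex a ℤ) (n m : ℤ) (hm : m + 1 = n)
    (z : Cocycle K L n) : homClass k K L n z = 0 ↔ ∃ β : Cochain K L m, δ m n β = z := by
  refine ⟨fun h => ?_, fun ⟨β, h⟩ => homClass_eq_zero K L n m hm z β h⟩
  refine (mem_coboundaries_iff z m hm).1 ((CohomologyClass.toHom_mk_eq_zero_iff z).1 ?_)
  rw [CohomologyClass.toHom_mk]
  change (HomotopyCategory.quotient a (.up ℤ)).map (Cocycle.equivHomShift.symm z) ≫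
    ((HomotopyCategory.quotient a (.up ℤ)).commShiftIso n).hom.app L = 0 at h
  exact (cancel_mono (((HomotopyCategory.quotient a (.up ℤ)).commShiftIso n).hom.app L)).1
    (h.trans Limits.zero_comp.symm)

variable {φ : GradedQuiver.cocycles (mult k a) 2} {C : CochainComplex a ℤ}

/-! ### Graded lifts as perturbations, and their curvature -/

namespace GradedLift

/-- The coefficient of `ε` in a graded lift. -/
def perturbation (L : GradedLift φ C) : Cochain C C 1 :=
  Cochain.mk fun p q _ => (L.d p q).coeff₁

/-- The graded lift `d + β ε`. -/
def ofCochain (φ : GradedQuiver.cocycles (mult k a) 2) (β : Cochain C C 1) : GradedLift φ C where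
  d i j := ⟨C.d i j, if h : i + 1 = j then β.v i j h else 0⟩
  -- A cochain has components only where i + 1 = j. The default value 0 elsewhere gives the shape
  -- condition on the coefficient of ε.
  shape i j h := Deformation.hom_ext (C.shape i j h) (dif_neg h)
  reduction_d _ _ := rfl

lemma perturbation_ofCochain (β : Cochain C C 1) : (ofCochain φ β).perturbation = β := by
  ext p q h
  exact dif_pos h

/-- Curvatures of different graded lifts differ by a coboundary. -/
lemma cocycle_eq (L : GradedLift φ C) :
    (L.cocycle : Cochain C C 2) = charCocycle φ C - δ 1 2 L.perturbation := by
  ext p q h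
  have hD : ∀ i j, (L.d i j).coeff₀ = C.d i j := L.reduction_d
  rw [Cochain.sub_v, charCocycle_v φ C p (p + 1) q rfl h,
    δ_v 1 2 rfl _ p q h (p + 1) (p + 1) (by omega) rfl]
  -- The sign in δ on degree one cochains is (-1)² = 1, so δβ is the sum of the two composites of d
  -- and β. These are the cross terms of (d + βε)², and the deformed composition contributes the
  -- remaining φ(d, d).
  simp only [cocycle, curvature, perturbation, Cocycle.mk_coe, Cochain.mk_v,
    Deformation.neg_coeff₁, Deformation.comp_coeff₁, hD, Int.negOnePow_even 2 ⟨1, rfl⟩, one_smul]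
  abel

/-- The right-hand side does not involve the lift, so this also shows that the obstruction is
independent of it. The reason is that changing the perturbation changes the curvature by a
coboundary. -/
lemma obstruction_eq (L : GradedLift φ C) :
    L.obstruction = homClass k C C 2 (charCocycle φ C) := by
  rw [obstruction, ← sub_eq_zero, ← map_sub]
  -- The sign of the bounding cochain comes from u - χ̄(φ)_C = -δβ.
  refine homClass_eq_zero C C 2 1 rfl _ (-L.perturbation) ?_
  rw [δ_neg, Cocycle.coe_sub, L.cocycle_eq]
  abel

/-- A graded lift of curvature zero is a complex over the deformation. -/
def toComplex (L : GradedLift φ C) (hL : (L.cocycle : Cochain C C 2) = 0) :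
    CochainComplex (Deformation φ) ℤ where
  X i := ⟨C.X i⟩
  d := L.d
  shape := L.shape
  d_comp_d' := by
    rintro p _ q rfl hq
    refine Deformation.hom_ext ?_ ?_
    · rw [Deformation.comp_coeff₀]
      -- The constant term of the deformed square is d² in C; only the coefficient of ε uses the
      -- hypothesis on the curvature.
      exact (congrArg₂ (· ≫ ·) (L.reduction_d _ _) (L.reduction_d _ _)).trans (C.d_comp_d _ _ _)
    · have h : p + 2 = q := by
        have : p + 1 + 1 = q := hq
        omega
      -- The component of u at (p, q) is by definition minus the coefficient of ε in the square, so
      -- its vanishing is the missing equation up to sign.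
      have := Cochain.congr_v hL p q h
      exact neg_eq_zero.1 this

/-- A complex over the deformation is a graded lift of its reduction. -/
def ofComplex (D : CochainComplex (Deformation φ) ℤ) :
    GradedLift φ (((Deformation.reduction φ).mapHomologicalComplex (.up ℤ)).obj D) where
  d := D.d
  shape i j h := D.shape i j h
  reduction_d _ _ := rfl

lemma cocycle_ofComplex (D : CochainComplex (Deformation φ) ℤ) : (ofComplex D).cocycle = 0 := by
  ext p q h
  change (-(D.d p (p + 1) ≫ D.d (p + 1) q)).coeff₁ = 0
  rw [D.d_comp_d, neg_zero]
  rfl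

end GradedLift

/-! ### Lifting complexes and vanishing of the characteristic class -/

/-- A cochain β with δβ = χ̄(φ)_C is exactly a perturbation that cancels the curvature, because d +
βε has curvature cocycle χ̄(φ)_C - δβ. The conclusion is an equality of complexes, stronger than the
homotopy equivalence needed later. -/
lemma exists_lift_of_homClass_eq_zero (h : homClass k C C 2 (charCocycle φ C) = 0) :
    ∃ D : CochainComplex (Deformation φ) ℤ,
      ((Deformation.reduction φ).mapHomologicalComplex (.up ℤ)).obj D = C := by
  obtain ⟨β, hβ⟩ := (homClass_eq_zero_iff C C 2 1 rfl _).1 h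
  let L := GradedLift.ofCochain φ β
  have hL : (L.cocycle : Cochain C C 2) = 0 := by
    rw [L.cocycle_eq, GradedLift.perturbation_ofCochain, hβ, sub_self]
  -- Objects and constant terms of the differentials were kept, so reducing modulo ε returns C
  -- definitionally.
  exact ⟨L.toComplex hL, rfl⟩

/-- D serves as a graded lift of its own reduction, with zero curvature. Since any graded lift
computes the class, the class is zero. -/
lemma homClass_reduction_eq_zero (D : CochainComplex (Deformation φ) ℤ) :
    homClass k _ _ 2 (charCocycle φ
      (((Deformation.reduction φ).mapHomologicalComplex (.up ℤ)).obj D)) = 0 := by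
  rw [← (GradedLift.ofComplex D).obstruction_eq, GradedLift.obstruction,
    GradedLift.cocycle_ofComplex, map_zero]

end

/-! ### Central elements and isomorphic objects -/

section

variable {k : Type w} [CommRing k] {T : Type u} [Category.{v} T] [Preadditive T] [Linear k T]
  [HasShift T ℤ] [∀ n : ℤ, (shiftFunctor T n).Additive] [∀ n : ℤ, (shiftFunctor T n).Linear k]

/-- Centrality against the degree zero morphism e gives ζ_Y e = e ζ_X = 0, and e can be cancelled.
This is how vanishing passes from a strict reduction to every object isomorphic to it in K(a). -/
lemma gradedCentre_eq_zero_of_iso {n : ℤ} (ζ : gradedCentre k T n) {X Y : T} (e : X ≅ Y)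
    (h : ζ.1 X = 0) : ζ.1 Y = 0 := by
  have := ζ.2 0 X Y (ShiftedHom.mk₀ 0 rfl e.hom)
  rw [h, ShiftedHom.zero_comp, smul_zero] at this
  -- The composite lives in degree 0 + n, which is not literally n. With the degree a variable l,
  -- the equation n = l can be substituted before composition with `mk₀` is simplified.
  have key : ∀ (l : ℤ) (hl : n + 0 = l),
      (ShiftedHom.mk₀ (0 : ℤ) rfl e.hom).comp (ζ.1 Y) hl = 0 → ζ.1 Y = 0 := by
    intro l hl hz
    obtain rfl : n = l := by omega
    rw [ShiftedHom.mk₀_comp] at hz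
    exact (cancel_epi e.hom).1 (hz.trans Limits.comp_zero.symm)
  exact key _ _ this

end

end HochChar

/-! ### Comparison of the characteristic morphism with the obstructions -/

theorem mainTheorem1 {k : Type w} [Field k] {a : Type u} [Category.{v} a] [Preadditive a]
    [Linear k a] :
    (∀ (φ : (HochChar.linQuiver k a).cochains 2) (C : CochainComplex a ℤ) (p q r : ℤ)
      (_ : p + 1 = q) (_ : q + 1 = r) (hpr : p + 2 = r),
      (HochChar.characteristicDg k a 2 φ C).v p r hpr =
        -HochChar.app₂ φ (C.d p q) (C.d q r)) ∧
    ∀ (c : HochChar.GradedQuiver.HH (HochChar.mult k a) 2)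
      (φ : HochChar.GradedQuiver.cocycles (HochChar.mult k a) 2),
      HochChar.GradedQuiver.HH.mk (HochChar.mult k a) 2 φ = c →
      ∀ C : HomotopyCategory a (ComplexShape.up ℤ),
        Nonempty (HochChar.GradedLift φ C.as) ∧
        (∀ L : HochChar.GradedLift φ C.as,
          (HochChar.characteristicMorphism c).1 C = L.obstruction) ∧
        ((HochChar.characteristicMorphism c).1 C = 0 ↔
          ∃ D : HomotopyCategory (HochChar.Deformation φ) (ComplexShape.up ℤ),
            Nonempty (((HochChar.Deformation.reduction φ).mapHomotopyCategory
              (ComplexShape.up ℤ)).obj D ≅ C)) := by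
  refine ⟨fun φ C p q r hq _ hpr => ?_, ?_⟩
  · subst hq
    exact HochChar.characteristicDg_two φ C p r hpr
  rintro _ φ rfl C
  -- The characteristic morphism is defined on cocycles and descends to the quotient, so on the
  -- class of φ it can be computed from φ itself.
  have hχ : (HochChar.characteristicMorphism
      (HochChar.GradedQuiver.HH.mk (HochChar.mult k a) 2 φ)).1 C =
        HochChar.homClass k C.as C.as 2 (HochChar.charCocycle φ C.as) := rfl
  refine ⟨⟨HochChar.GradedLift.trivial φ C.as⟩, fun L => hχ.trans L.obstruction_eq.symm,
    fun h => ?_, ?_⟩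
  · obtain ⟨D, hD⟩ := HochChar.exists_lift_of_homClass_eq_zero (hχ.symm.trans h)
    -- The lift reduces to C exactly, so the isomorphism in K(a) comes from an equality of objects.
    exact ⟨(HomotopyCategory.quotient _ _).obj D,
      ⟨eqToIso (congrArg (HomotopyCategory.quotient a (.up ℤ)).obj hD)⟩⟩
  · rintro ⟨D, ⟨e⟩⟩
    -- The class vanishes at the reduction of D, and centrality carries this along e to C.
    exact HochChar.gradedCentre_eq_zero_of_iso _ e (HochChar.homClass_reduction_eq_zero D.as)
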